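/- Let $G$ be a compact (Hausdorff) abelian group with Haar measure $\lambda$, and let $\Phi$ be an $N$-function, i.e. a convex even function $\Phi:\mathbb R\to[0,\infty)$ with $\Phi(0)=0$, $\lim_{x\to0}\Phi(x)/x=0$ and $\lim_{x\to\infty}\Phi(x)/x=\infty$. Let $\Psi(y)=\sup\{x|y|-\Phi(x):x\ge 0\}$ be its complementary function. For measurable $f:G\to\mathbb C$ put $\rho_\Phi(f)=\int_G\Phi(|f|)\,d\lambda$ and $N_\Phi(f)=\inf\{k>0:\rho_\Phi(f/k)\le 1\}$, let $\|g\|_\Psi=\sup\{\int_G|gh|\,d\lambda : h \text{ measurable},\ N_\Phi(h)\le 1\}$, and let $M^\Phi(G)$ be the space of measurable $f$ with $\rho_\Phi(af)<\infty$ for all $a>0$ (similarly $M^\Psi(G)$). Let $A_\Phi(G)$ be the space of all $u\in C_0(G)$ $(=C(G))$ of the form $u=\sum_{n=1}^\infty f_n*\check g_n$ with $f_n\in M^\Phi(G)$, $g_n\in M^\Psi(G)$ and $\sum_{n=1}^\infty N_\Phi(f_n)\|g_n\|_\Psi<\infty$, where $\check g(x)=g(x^{-1})$ and $(f*g)(x)=\int_G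 f(y)g(y^{-1}x)\,d\lambda(y)$, normed by the infimum $\|u\|_{A_\Phi}$ of $\sum_n N_\Phi(f_n)\|g_n\|_\Psi$ over all such representations of $u$. It is an algebra under convolution. Let $\Delta(A_\Phi(G))$ be the character space of $A_\Phi(G)$ with the convolution product: the set of all nonzero bounded linear functionals $\varphi$ on $A_\Phi(G)$ with $\varphi(u*v)=\varphi(u)\varphi(v)$ for all $u,v$, with the weak-$*$ topology. Then $\Delta(A_\Phi(G))$ is homeomorphic to the dual group $\widehat G$, the group of continuous characters $G\to\mathbb T$ with the compact-open topology. -/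

import Mathlib

open MeasureTheory Filter Topology
open scoped ENNReal ZeroAtInfty

set_option linter.unusedSectionVars false

noncomputable section

/-- An `N`-function: a convex even function `Φ : ℝ → [0, ∞)` with `Φ 0 = 0`,
`Φ x / x → 0` as `x → 0` and `Φ x / x → ∞` as `x → ∞`. -/
structure NFunction where
  toFun : ℝ → ℝ
  convexOn : ConvexOn ℝ Set.univ toFun
  even : ∀ x, toFun (-x) = toFun x
  nonneg : ∀ x, 0 ≤ toFun x
  map_zero : toFun 0 = 0
  tendsto_zero : Tendsto (fun x => toFun x / x) (𝓝[≠] 0) (𝓝 0)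
  tendsto_atTop : Tendsto (fun x => toFun x / x) atTop atTop

/-- The complementary function `Ψ y = sup {x |y| - Φ x : x ≥ 0}`. -/
def NFunction.compl (Φ : NFunction) (y : ℝ) : ℝ :=
  sSup ((fun x => x * |y| - Φ.toFun x) '' Set.Ici 0)

section Orlicz

variable {G : Type*} [MeasurableSpace G]

/-- The modular `ρ_Φ(f) = ∫ Φ(|f|) dμ`. -/
def orliczModular (Φ : ℝ → ℝ) (μ : Measure G) (f : G → ℂ) : ℝ≥0∞ :=
  ∫⁻ x, ENNReal.ofReal (Φ ‖f x‖) ∂μ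

/-- Membership in the Morse-Transue space `M^Φ(G)`. -/
def MemMorseTransue (Φ : ℝ → ℝ) (μ : Measure G) (f : G → ℂ) : Prop :=
  AEStronglyMeasurable f μ ∧ ∀ a : ℝ, 0 < a → orliczModular Φ μ (fun x => (a : ℂ) * f x) < ∞

/-- The Luxemburg-Nakano norm `N_Φ(f) = inf {k > 0 : ρ_Φ(f / k) ≤ 1}`, with values in `[0, ∞]`
(it is `∞` if there is no such `k`). -/
def luxemburgNorm (Φ : ℝ → ℝ) (μ : Measure G) (f : G → ℂ) : ℝ≥0∞ :=
  ⨅ (k : ℝ) (_ : 0 < k ∧ orliczModular Φ μ (fun x => f x / (k : ℂ)) ≤ 1), ENNReal.ofReal k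

/-- The Orlicz norm `sup {∫ |g h| dμ : h measurable, N_Φ(h) ≤ 1}`, with values in `[0, ∞]`. For a
complementary pair `(Φ, Ψ)`, each function being the complementary function of the other, this is
the Orlicz norm `‖g‖_Ψ` of the space `L^Ψ(G)`: the argument `Φ` is the function complementary to
the one that indexes the norm. -/
def orliczNorm (Φ : ℝ → ℝ) (μ : Measure G) (g : G → ℂ) : ℝ≥0∞ :=
  ⨆ (h : G → ℂ) (_ : AEStronglyMeasurable h μ ∧ luxemburgNorm Φ μ h ≤ 1),
    ∫⁻ x, ‖g x * h x‖ₑ ∂μ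

/-- The convolution `(f * g)(x) = ∫ f(y) g(y⁻¹ x) dμ(y)`. -/
def haarConv [Group G] (μ : Measure G) (f g : G → ℂ) (x : G) : ℂ :=
  ∫ y, f y * g (y⁻¹ * x) ∂μ

end Orlicz

namespace NFunction

theorem measurable (Φ : NFunction) : Measurable Φ.toFun := by
  have h := Φ.convexOn.continuousOn_interior
  rw [interior_univ, continuousOn_univ] at h
  exact h.measurable

theorem map_div_le (Φ : NFunction) {k : ℝ} (hk : 1 ≤ k) (t : ℝ) :
    Φ.toFun (t / k) ≤ Φ.toFun t / k := by
  have hk0 : 0 < k := by linarith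
  have h := (Φ.convexOn).2 (Set.mem_univ t) (Set.mem_univ 0) 
    (show (0 : ℝ) ≤ 1 / k by positivity)
    (show (0 : ℝ) ≤ 1 - 1 / k by rw [sub_nonneg, div_le_one hk0]; exact hk) (by ring)
  simp only [smul_eq_mul, mul_zero, add_zero, Φ.map_zero] at h
  calc Φ.toFun (t / k) = Φ.toFun (1 / k * t) := by ring_nf
    _ ≤ 1 / k * Φ.toFun t := h
    _ = Φ.toFun t / k := by ring

theorem mono (Φ : NFunction) {s t : ℝ} (hs : 0 ≤ s) (hst : s ≤ t) : Φ.toFun s ≤ Φ.toFun t := by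
  rcases hs.eq_or_lt with rfl | hs
  · rw [Φ.map_zero]; exact Φ.nonneg t
  have ht : 0 < t := hs.trans_le hst
  have h1 : 1 ≤ t / s := (one_le_div hs).2 hst
  have h := Φ.map_div_le h1 t
  have e : t / (t / s) = s := by field_simp
  rw [e] at h
  exact h.trans (div_le_self (Φ.nonneg t) h1)

theorem compl_bddAbove (Φ : NFunction) (y : ℝ) :
    BddAbove ((fun x => x * |y| - Φ.toFun x) '' Set.Ici 0) := by
  obtain ⟨X, hX⟩ := eventually_atTop.1 (Φ.tendsto_atTop.eventually_ge_atTop |y|)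
  refine ⟨max X 0 * |y|, ?_⟩
  rintro _ ⟨x, hx, rfl⟩
  simp only [Set.mem_Ici] at hx
  have hm : 0 ≤ max X 0 * |y| := by positivity
  rcases hx.eq_or_lt with rfl | hx
  · simpa [Φ.map_zero] using hm
  rcases le_total X x with h | h
  · have := hX x h
    rw [le_div_iff₀ hx] at this
    simp only
    linarith
  · have h1 : x * |y| ≤ max X 0 * |y| := by gcongr; exact h.trans (le_max_left _ _)
    have := Φ.nonneg x
    simp only
    linarith

/-- Young's inequality. -/
theorem young (Φ : NFunction) {x y : ℝ} (hx : 0 ≤ x) (hy : 0 ≤ y) :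
    x * y ≤ Φ.toFun x + Φ.compl y := by
  have h := le_csSup (Φ.compl_bddAbove y) ⟨x, hx, rfl⟩
  simp only [abs_of_nonneg hy] at h
  unfold compl
  rw [abs_of_nonneg hy]
  linarith

theorem compl_nonneg (Φ : NFunction) (y : ℝ) : 0 ≤ Φ.compl y := by
  have h := le_csSup (Φ.compl_bddAbove y) ⟨0, Set.self_mem_Ici, rfl⟩
  simpa [compl, Φ.map_zero] using h

theorem compl_mono (Φ : NFunction) {s t : ℝ} (hs : 0 ≤ s) (hst : s ≤ t) :
    Φ.compl s ≤ Φ.compl t := by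
  refine csSup_le (Set.Nonempty.image _ ⟨0, Set.self_mem_Ici⟩) ?_
  rintro _ ⟨x, hx, rfl⟩
  refine le_trans ?_ (le_csSup (Φ.compl_bddAbove t) ⟨x, hx, rfl⟩)
  have : |s| ≤ |t| := by rwa [abs_of_nonneg hs, abs_of_nonneg (hs.trans hst)]
  have := mul_le_mul_of_nonneg_left this hx
  simp only
  linarith

end NFunction

section OrliczFacts

variable {G : Type*} [MeasurableSpace G] {μ : Measure G}

theorem luxemburgNorm_zero (Φ : NFunction) : luxemburgNorm Φ.toFun μ (fun _ => 0) = 0 := by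
  refine le_antisymm (ENNReal.le_of_forall_pos_le_add fun ε hε _ => ?_) zero_le
  refine iInf₂_le_of_le (ε : ℝ) ⟨by exact_mod_cast hε, ?_⟩ ?_
  · simp [orliczModular, Φ.map_zero]
  · simp

theorem luxemburgNorm_smul_le (Φ : NFunction) (c : ℂ) (f : G → ℂ) :
    luxemburgNorm Φ.toFun μ (fun x => c * f x) ≤ ‖c‖ₑ * luxemburgNorm Φ.toFun μ f := by
  by_cases hc : c = 0
  · simp [hc, luxemburgNorm_zero]
  have hc' : 0 < ‖c‖ := norm_pos_iff.2 hc
  unfold luxemburgNorm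
  rw [ENNReal.mul_iInf_of_ne (by simpa using hc) (by simp)]
  refine le_iInf fun k => ?_
  rw [ENNReal.mul_iInf_of_ne (by simpa using hc) (by simp)]
  refine le_iInf fun hk => ?_
  refine iInf₂_le_of_le (‖c‖ * k) ⟨by have := hk.1; positivity, ?_⟩ ?_
  · convert hk.2 using 1
    unfold orliczModular
    congr 1
    ext x
    congr 2
    simp only [norm_div, norm_mul, Complex.norm_real, norm_norm]
    field_simp
  · rw [ENNReal.ofReal_mul hc'.le, ofReal_norm]

theorem luxemburgNorm_lt_top (Φ : NFunction) {f : G → ℂ} (hf : MemMorseTransue Φ.toFun μ f) :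
    luxemburgNorm Φ.toFun μ f < ∞ := by
  have h1 := hf.2 1 one_pos
  simp only [Complex.ofReal_one, one_mul] at h1
  set M := (orliczModular Φ.toFun μ f).toReal with hM
  have hk : 1 ≤ max 1 M := le_max_left _ _
  have hk0 : 0 < max 1 M := by linarith
  refine lt_of_le_of_lt (iInf₂_le (max 1 M) ⟨hk0, ?_⟩) ENNReal.ofReal_lt_top
  have : orliczModular Φ.toFun μ (fun x => f x / ((max 1 M : ℝ) : ℂ))
      ≤ ENNReal.ofReal (1 / max 1 M) * orliczModular Φ.toFun μ f := by
    unfold orliczModular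
    rw [← lintegral_const_mul' _ _ ENNReal.ofReal_ne_top]
    refine lintegral_mono fun x => ?_
    rw [← ENNReal.ofReal_mul (by positivity)]
    refine ENNReal.ofReal_le_ofReal ?_
    rw [norm_div, Complex.norm_real, Real.norm_of_nonneg hk0.le, one_div_mul_eq_div]
    exact Φ.map_div_le hk _
  refine this.trans ?_
  rw [← ENNReal.ofReal_toReal h1.ne, ← hM, ← ENNReal.ofReal_mul (by positivity),
    ENNReal.ofReal_le_one, one_div_mul_eq_div, div_le_one hk0]
  exact le_max_right _ _

theorem orliczNorm_lt_top (Φ : NFunction) {g : G → ℂ} (hg : MemMorseTransue Φ.compl μ g) :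
    orliczNorm Φ.toFun μ g < ∞ := by
  have h2 := hg.2 2 two_pos
  refine lt_of_le_of_lt (b := 1 + orliczModular Φ.compl μ (fun x => ((2 : ℝ) : ℂ) * g x)) ?_
    (ENNReal.add_lt_top.2 ⟨ENNReal.one_lt_top, h2⟩)
  refine iSup₂_le fun h hh => ?_
  have hlt : luxemburgNorm Φ.toFun μ h < ENNReal.ofReal 2 :=
    lt_of_le_of_lt hh.2 (by rw [ENNReal.one_lt_ofReal]; norm_num)
  unfold luxemburgNorm at hlt
  simp only [iInf_lt_iff] at hlt
  obtain ⟨k, ⟨hk, hmod⟩, hk2⟩ := hlt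
  rw [ENNReal.ofReal_lt_ofReal_iff two_pos] at hk2
  refine le_trans ?_ (add_le_add_left hmod _)
  unfold orliczModular
  rw [← lintegral_add_left']
  · refine lintegral_mono fun x => ?_
    rw [← ENNReal.ofReal_add (Φ.nonneg _) (Φ.compl_nonneg _), ← ofReal_norm]
    refine ENNReal.ofReal_le_ofReal ?_
    have e : ‖g x * h x‖ = ‖h x / (k : ℂ)‖ * (k * ‖g x‖) := by
      rw [norm_mul, norm_div, Complex.norm_real, Real.norm_of_nonneg hk.le]
      field_simp
    rw [e]
    refine (Φ.young (norm_nonneg _) (by positivity)).trans (add_le_add_right ?_ _)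
    refine Φ.compl_mono (by positivity) ?_
    rw [norm_mul, Complex.norm_real, Real.norm_of_nonneg two_pos.le]
    gcongr
  · have : AEMeasurable (fun x => ‖h x / (k : ℂ)‖) μ := (hh.1.aemeasurable.div_const _).norm
    exact (Φ.measurable.comp_aemeasurable this).ennreal_ofReal

/-- Hölder's inequality. -/
theorem lintegral_enorm_mul_le (Φ : NFunction) {f g : G → ℂ} (hf : AEStronglyMeasurable f μ)
    (hf' : luxemburgNorm Φ.toFun μ f < ∞) (hg : orliczNorm Φ.toFun μ g < ∞) :
    ∫⁻ x, ‖f x * g x‖ₑ ∂μ ≤ luxemburgNorm Φ.toFun μ f * orliczNorm Φ.toFun μ g := by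
  have key : ∀ k : ℝ, 0 < k ∧ orliczModular Φ.toFun μ (fun x => f x / (k : ℂ)) ≤ 1 →
      ∫⁻ x, ‖f x * g x‖ₑ ∂μ ≤ ENNReal.ofReal k * orliczNorm Φ.toFun μ g := by
    rintro k ⟨hk, hm⟩
    have h1 : luxemburgNorm Φ.toFun μ (fun x => f x / (k : ℂ)) ≤ 1 := by
      refine iInf₂_le_of_le 1 ⟨one_pos, ?_⟩ (by simp)
      simpa using hm
    have h2 : ∫⁻ x, ‖g x * (f x / (k : ℂ))‖ₑ ∂μ ≤ orliczNorm Φ.toFun μ g :=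
      le_iSup₂_of_le (fun x => f x / (k : ℂ))
        ⟨(hf.aemeasurable.div_const _).aestronglyMeasurable, h1⟩ le_rfl
    refine le_trans (le_of_eq ?_) (mul_le_mul_right h2 _)
    rw [← lintegral_const_mul' _ _ ENNReal.ofReal_ne_top]
    congr 1
    ext x
    rw [← ofReal_norm, ← ofReal_norm, ← ENNReal.ofReal_mul hk.le, norm_mul,
      norm_mul, norm_div, Complex.norm_real, Real.norm_of_nonneg hk.le]
    congr 1
    field_simp
  by_cases h0 : orliczNorm Φ.toFun μ g = 0
  · have := hf'
    unfold luxemburgNorm at this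
    simp only [iInf_lt_iff] at this
    obtain ⟨k, hk, -⟩ := this
    have := key k hk
    rw [h0, mul_zero] at this ⊢
    exact this
  · unfold luxemburgNorm
    rw [ENNReal.iInf_mul_of_ne h0 hg.ne]
    refine le_iInf fun k => ?_
    rw [ENNReal.iInf_mul_of_ne h0 hg.ne]
    exact le_iInf fun hk => key k hk

end OrliczFacts

section FTHO

variable {G : Type*} [Group G] [TopologicalSpace G] [MeasurableSpace G]

/-- `∑ N_Φ(f_n) ‖g_n‖_Ψ`, where `Ψ` is the complementary function of `Φ`. -/
def fthoCost (Φ : NFunction) (μ : Measure G) (f g : ℕ → G → ℂ) : ℝ≥0∞ :=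
  ∑' n, luxemburgNorm Φ.toFun μ (f n) * orliczNorm Φ.toFun μ (g n)

/-- The sequences `f_n ∈ M^Φ(G)`, `g_n ∈ M^Ψ(G)` represent `u`: one has
`∑ N_Φ(f_n) ‖g_n‖_Ψ < ∞` and `u = ∑ f_n * ǧ_n`, where `ǧ x = g x⁻¹`. -/
structure IsFthoRep (Φ : NFunction) (μ : Measure G) (u : G → ℂ) (f g : ℕ → G → ℂ) : Prop where
  left_mem : ∀ n, MemMorseTransue Φ.toFun μ (f n)
  right_mem : ∀ n, MemMorseTransue Φ.compl μ (g n)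
  cost_lt : fthoCost Φ μ f g < ∞
  hasSum : ∀ x, HasSum (fun n => haarConv μ (f n) (fun y => g n y⁻¹) x) (u x)


variable {Φ : NFunction} {μ : Measure G}

theorem luxemburgNorm_comp_mul_left [ContinuousMul G] [BorelSpace G] [μ.IsMulLeftInvariant]
    (x : G) (f : G → ℂ) :
    luxemburgNorm Φ.toFun μ (fun y => f (x * y)) = luxemburgNorm Φ.toFun μ f := by
  unfold luxemburgNorm orliczModular
  congr 1
  ext k
  rw [lintegral_mul_left_eq_self (μ := μ)
    (fun y => ENNReal.ofReal (Φ.toFun ‖f y / (k : ℂ)‖)) x]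

theorem enorm_haarConv_le [ContinuousMul G] [BorelSpace G] [μ.IsMulLeftInvariant] {f g : G → ℂ}
    (hf : MemMorseTransue Φ.toFun μ f) (hg : MemMorseTransue Φ.compl μ g) (x : G) :
    ‖haarConv μ f (fun y => g y⁻¹) x‖ₑ
      ≤ luxemburgNorm Φ.toFun μ f * orliczNorm Φ.toFun μ g := by
  refine (enorm_integral_le_lintegral_enorm _).trans ?_
  rw [← lintegral_mul_left_eq_self _ x, ← luxemburgNorm_comp_mul_left x f]
  simp only [mul_inv_rev, inv_inv, inv_mul_cancel_left]
  refine lintegral_enorm_mul_le Φ ?_ ?_ (orliczNorm_lt_top Φ hg)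
  · exact hf.1.comp_quasiMeasurePreserving
      (measurePreserving_mul_left μ x).quasiMeasurePreserving
  · rw [luxemburgNorm_comp_mul_left]
    exact luxemburgNorm_lt_top Φ hf

theorem haarConv_const_mul (c : ℂ) (f g : G → ℂ) (x : G) :
    haarConv μ (fun y => c * f y) g x = c * haarConv μ f g x := by
  simp only [haarConv, mul_assoc, integral_const_mul]

theorem memMorseTransue_zero {Φ : ℝ → ℝ} (h : Φ 0 = 0) : MemMorseTransue Φ μ (fun _ : G => 0) :=
  ⟨aestronglyMeasurable_const, fun a _ => by simp [orliczModular, h]⟩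

theorem NFunction.compl_zero (Φ : NFunction) : Φ.compl 0 = 0 := by
  refine le_antisymm (csSup_le (Set.Nonempty.image _ ⟨0, Set.self_mem_Ici⟩) ?_) (Φ.compl_nonneg 0)
  rintro _ ⟨x, -, rfl⟩
  simpa using Φ.nonneg x

theorem IsFthoRep.zero : IsFthoRep Φ μ (fun _ : G => 0) (fun _ _ => 0) (fun _ _ => 0) where
  left_mem _ := memMorseTransue_zero Φ.map_zero
  right_mem _ := memMorseTransue_zero Φ.compl_zero
  cost_lt := by simp [fthoCost, luxemburgNorm_zero]
  hasSum x := by simp [haarConv, hasSum_zero]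

theorem MemMorseTransue.const_mul {Φ : NFunction} {f : G → ℂ} (hf : MemMorseTransue Φ.toFun μ f)
    (c : ℂ) : MemMorseTransue Φ.toFun μ (fun x => c * f x) := by
  by_cases hc : c = 0
  · simpa [hc] using memMorseTransue_zero Φ.map_zero
  refine ⟨hf.1.const_mul c, fun a ha => ?_⟩
  have h := hf.2 (a * ‖c‖) (by have := norm_pos_iff.2 hc; positivity)
  unfold orliczModular at h ⊢
  have e : ∀ x, ‖(a : ℂ) * (c * f x)‖ = ‖((a * ‖c‖ : ℝ) : ℂ) * f x‖ := fun x => by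
    simp [mul_assoc]
  simpa only [e] using h

theorem fthoCost_smul_le (c : ℂ) (f g : ℕ → G → ℂ) :
    fthoCost Φ μ (fun n x => c * f n x) g ≤ ‖c‖ₑ * fthoCost Φ μ f g := by
  unfold fthoCost
  rw [← ENNReal.tsum_mul_left]
  refine ENNReal.tsum_le_tsum fun n => ?_
  rw [← mul_assoc]
  exact mul_le_mul_left (luxemburgNorm_smul_le Φ c (f n)) _

theorem IsFthoRep.const_mul {u : G → ℂ} {f g : ℕ → G → ℂ} (h : IsFthoRep Φ μ u f g) (c : ℂ) :
    IsFthoRep Φ μ (fun x => c * u x) (fun n x => c * f n x) g where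
  left_mem n := (h.left_mem n).const_mul c
  right_mem := h.right_mem
  cost_lt := (fthoCost_smul_le c f g).trans_lt (ENNReal.mul_lt_top enorm_lt_top h.cost_lt)
  hasSum x := by simpa only [haarConv_const_mul] using (h.hasSum x).mul_left c

/-- Two sequences interleaved. -/
def interleave (f f' : ℕ → G → ℂ) (n : ℕ) : G → ℂ :=
  Sum.elim f f' (Equiv.natSumNatEquivNat.symm n)

theorem fthoCost_interleave (f g f' g' : ℕ → G → ℂ) :
    fthoCost Φ μ (interleave f f') (interleave g g') = fthoCost Φ μ f g + fthoCost Φ μ f' g' := by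
  unfold fthoCost
  rw [← Equiv.natSumNatEquivNat.tsum_eq, ENNReal.summable.tsum_sum ENNReal.summable]
  simp only [interleave, Equiv.symm_apply_apply, Sum.elim_inl, Sum.elim_inr]

theorem IsFthoRep.add {u u' : G → ℂ} {f g f' g' : ℕ → G → ℂ} (h : IsFthoRep Φ μ u f g)
    (h' : IsFthoRep Φ μ u' f' g') :
    IsFthoRep Φ μ (fun x => u x + u' x) (interleave f f') (interleave g g') where
  left_mem n := by
    unfold interleave
    rcases Equiv.natSumNatEquivNat.symm n with m | m
    · exact h.left_mem m
    · exact h'.left_mem m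
  right_mem n := by
    unfold interleave
    rcases Equiv.natSumNatEquivNat.symm n with m | m
    · exact h.right_mem m
    · exact h'.right_mem m
  cost_lt := by
    rw [fthoCost_interleave]
    exact ENNReal.add_lt_top.2 ⟨h.cost_lt, h'.cost_lt⟩
  hasSum x := by
    rw [← Equiv.natSumNatEquivNat.hasSum_iff]
    refine HasSum.sum ?_ ?_
    · simpa only [Function.comp_def, interleave, Equiv.symm_apply_apply, Sum.elim_inl]
        using h.hasSum x
    · simpa only [Function.comp_def, interleave, Equiv.symm_apply_apply, Sum.elim_inr]
        using h'.hasSum x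

/-- `‖u‖_{A_Φ}`, with values in `[0, ∞]`: the infimum of `∑ N_Φ(f_n) ‖g_n‖_Ψ` over all
representations of `u`. -/
def fthoENorm (Φ : NFunction) (μ : Measure G) (u : G → ℂ) : ℝ≥0∞ :=
  ⨅ (p : (ℕ → G → ℂ) × (ℕ → G → ℂ)) (_ : IsFthoRep Φ μ u p.1 p.2), fthoCost Φ μ p.1 p.2

theorem IsFthoRep.fthoENorm_le {u : G → ℂ} {f g : ℕ → G → ℂ} (h : IsFthoRep Φ μ u f g) :
    fthoENorm Φ μ u ≤ fthoCost Φ μ f g :=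
  iInf₂_le (f, g) h

theorem fthoENorm_add_le (u v : G → ℂ) :
    fthoENorm Φ μ (fun x => u x + v x) ≤ fthoENorm Φ μ u + fthoENorm Φ μ v := by
  conv_rhs => unfold fthoENorm
  simp only [ENNReal.iInf_add, ENNReal.add_iInf]
  refine le_iInf fun p => le_iInf fun q => le_iInf fun hp => le_iInf fun hq => ?_
  refine (IsFthoRep.add ?_ ?_).fthoENorm_le.trans (fthoCost_interleave _ _ _ _).le
  all_goals assumption

theorem fthoENorm_const_mul_le (c : ℂ) (u : G → ℂ) :
    fthoENorm Φ μ (fun x => c * u x) ≤ ‖c‖ₑ * fthoENorm Φ μ u := by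
  by_cases hc : c = 0
  · have := (IsFthoRep.zero (Φ := Φ) (μ := μ)).fthoENorm_le
    simpa [hc, fthoCost, luxemburgNorm_zero] using this
  conv_rhs => unfold fthoENorm
  rw [ENNReal.mul_iInf_of_ne (by simpa using hc) (by simp)]
  refine le_iInf fun p => ?_
  rw [ENNReal.mul_iInf_of_ne (by simpa using hc) (by simp)]
  exact le_iInf fun hp => (hp.const_mul c).fthoENorm_le.trans (fthoCost_smul_le c _ _)

theorem enorm_le_fthoENorm [ContinuousMul G] [BorelSpace G] [μ.IsMulLeftInvariant]
    (u : G → ℂ) (x : G) : ‖u x‖ₑ ≤ fthoENorm Φ μ u := by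
  refine le_iInf₂ fun p hp => ?_
  rw [← (hp.hasSum x).tsum_eq]
  exact enorm_tsum_le_tsum_enorm.trans
    (ENNReal.tsum_le_tsum fun n => enorm_haarConv_le (hp.left_mem n) (hp.right_mem n) x)

/-- The space `A_Φ(G)` as a subspace of `C₀(G)`. -/
def fthoSubmodule (Φ : NFunction) (μ : Measure G) : Submodule ℂ C₀(G, ℂ) where
  carrier := {u | ∃ f g : ℕ → G → ℂ, IsFthoRep Φ μ u f g}
  zero_mem' := ⟨_, _, IsFthoRep.zero⟩
  add_mem' := by
    rintro u v ⟨f, g, h⟩ ⟨f', g', h'⟩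
    exact ⟨_, _, h.add h'⟩
  smul_mem' := by
    rintro c u ⟨f, g, h⟩
    exact ⟨_, _, h.const_mul c⟩

/-- The Figà-Talamanca-Herz-Orlicz space `A_Φ(G)`, with its own norm (not the supremum norm). -/
def FTHO (Φ : NFunction) (μ : Measure G) : Type _ := fthoSubmodule Φ μ

namespace FTHO

instance : AddCommGroup (FTHO Φ μ) := inferInstanceAs (AddCommGroup (fthoSubmodule Φ μ))

instance : Module ℂ (FTHO Φ μ) := inferInstanceAs (Module ℂ (fthoSubmodule Φ μ))

instance : CoeFun (FTHO Φ μ) (fun _ => G → ℂ) := ⟨fun u => u.1⟩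

@[ext]
theorem ext {u v : FTHO Φ μ} (h : ∀ x, u x = v x) : u = v :=
  Subtype.ext (DFunLike.ext _ _ h)

@[simp]
theorem zero_apply (x : G) : (0 : FTHO Φ μ) x = 0 := rfl

@[simp]
theorem add_apply (u v : FTHO Φ μ) (x : G) : (u + v) x = u x + v x := rfl

@[simp]
theorem smul_apply (c : ℂ) (u : FTHO Φ μ) (x : G) : (c • u) x = c * u x := rfl

theorem continuous (u : FTHO Φ μ) : Continuous u := u.1.continuous

theorem fthoENorm_ne_top (u : FTHO Φ μ) : fthoENorm Φ μ u ≠ ∞ := by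
  obtain ⟨f, g, h⟩ := u.2
  exact (h.fthoENorm_le.trans_lt h.cost_lt).ne

/-- The norm of `A_Φ(G)`. -/
instance : Norm (FTHO Φ μ) := ⟨fun u => (fthoENorm Φ μ u).toReal⟩

theorem norm_def (u : FTHO Φ μ) : ‖u‖ = (fthoENorm Φ μ u).toReal := rfl

theorem norm_smul_le' (c : ℂ) (u : FTHO Φ μ) : ‖c • u‖ ≤ ‖c‖ * ‖u‖ := by
  have h := fthoENorm_const_mul_le (Φ := Φ) (μ := μ) c u
  have := ENNReal.toReal_mono (ENNReal.mul_ne_top enorm_ne_top (fthoENorm_ne_top u)) h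
  rwa [ENNReal.toReal_mul, toReal_enorm] at this

variable [IsTopologicalGroup G] [BorelSpace G]

theorem normCore [μ.IsMulLeftInvariant] : NormedSpace.Core ℂ (FTHO Φ μ) where
  norm_nonneg _ := ENNReal.toReal_nonneg
  norm_smul c u := by
    refine le_antisymm (norm_smul_le' c u) ?_
    by_cases hc : c = 0
    · rw [hc, norm_zero, zero_mul]
      exact ENNReal.toReal_nonneg
    have h := norm_smul_le' c⁻¹ (c • u)
    rw [inv_smul_smul₀ hc, norm_inv] at h
    rwa [← le_inv_mul_iff₀ (norm_pos_iff.2 hc)]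
  norm_triangle u v := by
    simp only [norm_def]
    rw [← ENNReal.toReal_add (fthoENorm_ne_top u) (fthoENorm_ne_top v)]
    exact ENNReal.toReal_mono
      (ENNReal.add_ne_top.2 ⟨fthoENorm_ne_top u, fthoENorm_ne_top v⟩) (fthoENorm_add_le u v)
  norm_eq_zero_iff u := by
    constructor
    · intro h
      rw [norm_def, ENNReal.toReal_eq_zero_iff, or_iff_left (fthoENorm_ne_top u)] at h
      ext x
      have := enorm_le_fthoENorm (Φ := Φ) (μ := μ) u x
      rw [h] at this
      simpa using this
    · rintro rfl
      have := norm_smul_le' (Φ := Φ) (μ := μ) 0 0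
      rw [zero_smul, norm_zero, zero_mul] at this
      exact le_antisymm this ENNReal.toReal_nonneg

instance [μ.IsMulLeftInvariant] : NormedAddCommGroup (FTHO Φ μ) := .ofCore (normCore (Φ := Φ))

instance [μ.IsMulLeftInvariant] : NormedSpace ℂ (FTHO Φ μ) := .ofCore normCore

section Compact

variable [CompactSpace G] [IsFiniteMeasureOnCompacts μ]

theorem continuous_haarConv {f g : G → ℂ} (hf : Continuous f) (hg : Continuous g) :
    Continuous (haarConv μ f g) := by
  rw [← continuousOn_univ]
  refine continuousOn_integral_of_compact_support isCompact_univ ?_ (by simp)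
  exact Continuous.continuousOn (by fun_prop)

theorem memMorseTransue_of_continuous {Φ : ℝ → ℝ}
    (hΦ : ∀ s t, 0 ≤ s → s ≤ t → Φ s ≤ Φ t) {f : G → ℂ} (hf : Continuous f) :
    MemMorseTransue Φ μ f := by
  refine ⟨hf.aestronglyMeasurable, fun a ha => ?_⟩
  obtain ⟨C, hC⟩ := isCompact_univ.exists_bound_of_continuousOn hf.continuousOn
  have : orliczModular Φ μ (fun x => (a : ℂ) * f x)
      ≤ ∫⁻ _, ENNReal.ofReal (Φ (a * C)) ∂μ := by
    refine lintegral_mono fun x => ENNReal.ofReal_le_ofReal (hΦ _ _ (norm_nonneg _) ?_)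
    rw [norm_mul, Complex.norm_real, Real.norm_of_nonneg ha.le]
    have := hC x (Set.mem_univ x)
    gcongr
  refine this.trans_lt ?_
  rw [lintegral_const]
  exact ENNReal.mul_lt_top ENNReal.ofReal_lt_top isCompact_univ.measure_lt_top

/-- For compact `G`, the convolution of two continuous functions is in `A_Φ(G)`. -/
theorem isFthoRep_haarConv {u v : G → ℂ} (hu : Continuous u) (hv : Continuous v) :
    IsFthoRep Φ μ (haarConv μ u v) (fun n x => if n = 0 then u x else 0)
      (fun n x => if n = 0 then v x⁻¹ else 0) := by
  have hl : MemMorseTransue Φ.toFun μ u :=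
    memMorseTransue_of_continuous (fun _ _ => Φ.mono) hu
  have hr : MemMorseTransue Φ.compl μ (fun x => v x⁻¹) :=
    memMorseTransue_of_continuous (fun _ _ => Φ.compl_mono) (by fun_prop)
  refine ⟨fun n => ?_, fun n => ?_, ?_, fun x => ?_⟩
  · by_cases hn : n = 0
    · simpa [hn] using hl
    · simpa [hn] using memMorseTransue_zero Φ.map_zero
  · by_cases hn : n = 0
    · simpa [hn] using hr
    · simpa [hn] using memMorseTransue_zero Φ.compl_zero
  · unfold fthoCost
    rw [tsum_eq_single 0 (fun n hn => by simp [hn, luxemburgNorm_zero])]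
    simpa using ENNReal.mul_lt_top (luxemburgNorm_lt_top Φ hl) (orliczNorm_lt_top Φ hr)
  · convert hasSum_single 0 (fun n hn => ?_) using 1
    · simp
    · simp [hn, haarConv]

/-- Convolution as the product of `A_Φ(G)`, for a compact group `G`. -/
instance : Mul (FTHO Φ μ) :=
  ⟨fun u v => ⟨ZeroAtInftyContinuousMap.ContinuousMap.liftZeroAtInfty
      ⟨haarConv μ u v, continuous_haarConv u.continuous v.continuous⟩,
    ⟨_, _, isFthoRep_haarConv u.continuous v.continuous⟩⟩⟩

theorem mul_apply (u v : FTHO Φ μ) (x : G) : (u * v) x = ∫ y, u y * v (y⁻¹ * x) ∂μ := rfl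

theorem integrable_of_continuous {f : G → ℂ} (hf : Continuous f) : Integrable f μ :=
  hf.integrable_of_hasCompactSupport (HasCompactSupport.of_compactSpace f)

/-- `A_Φ(G)` with the convolution product, for a compact group `G`. -/
instance [μ.IsMulLeftInvariant] : NonUnitalRing (FTHO Φ μ) where
  left_distrib u v w := by
    ext x
    have hu := u.continuous
    have hv := v.continuous
    have hw := w.continuous
    simp only [mul_apply, add_apply, mul_add]
    exact integral_add (integrable_of_continuous (by fun_prop))
      (integrable_of_continuous (by fun_prop))
  right_distrib u v w := by
    ext x
    have hu := u.continuous
    have hv := v.continuous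
    have hw := w.continuous
    simp only [mul_apply, add_apply, add_mul]
    exact integral_add (integrable_of_continuous (by fun_prop))
      (integrable_of_continuous (by fun_prop))
  zero_mul u := by ext x; simp [mul_apply]
  mul_zero u := by ext x; simp [mul_apply]
  mul_assoc u v w := by
    ext x
    have hu := u.continuous
    have hv := v.continuous
    have hw := w.continuous
    simp only [mul_apply, ← integral_mul_const, ← integral_const_mul]
    rw [integral_integral_swap_of_hasCompactSupport (by fun_prop)
      (HasCompactSupport.of_compactSpace _)]
    congr 1
    ext z
    rw [← integral_mul_left_eq_self _ z]
    simp only [mul_inv_rev, inv_mul_cancel_left, mul_assoc]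

end Compact

end FTHO

end FTHO
end

/-!
Every continuous character `χ` of `G` gives the functional `u ↦ ∫ u χ dμ` on `A_Φ(G)`; it is
bounded because the norm of `A_Φ(G)` dominates the supremum norm, and multiplicative by Fubini and
the invariance of `μ`. The function `μ(G) χ⁻¹ = χ⁻¹ * χ⁻¹` lies in `A_Φ(G)`, and by orthogonality
it is killed by the functional of every character other than `χ`, but not by that of `χ`. So the
functionals are nonzero and distinct, and each is isolated in the weak-* topology.

It remains to see that every multiplicative functional `φ ≠ 0` has this form
(`exists_eq_fourierCLM`). This needs neither Peter–Weyl, nor the completeness of `A_Φ(G)`, nor the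
density of continuous functions in `M^Φ(G)`. Fix `v` with `φ(v) ≠ 0`. Since the Luxemburg norm is
bounded by a multiple of the supremum norm, `f ↦ f * v` is a bounded map `C(G) → A_Φ(G)`
(`convCLM`), so that `f ↦ φ(f * v)` is a bounded functional on the Banach space `C(G)`. Translation
is continuous in `C(G)`, hence `χ(x) = φ(L_x v * v) / φ(v * v)` is continuous and bounded; as `G` is
abelian, `(L_x v * v) * (L_y v * v) = (L_{xy} v * v) * (v * v)`, so `χ` is multiplicative, and
being bounded it has values in the unit circle. Finally `f * v = ∫ f(y) L_y v dμ(y)` is a Bochner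
integral in `C(G)`, and applying the functional gives
`φ(f) φ(v * v) = φ((f * v) * v) = ∫ f(y) φ(L_y v * v) dμ(y) = φ(v * v) ∫ f χ dμ`.

As the dual of a compact group is discrete, the bijection is a homeomorphism.
-/

/-! ### The Luxemburg norm of a bounded function -/

/-- On a finite measure space, the Luxemburg norm is bounded by a multiple of the supremum norm. -/
theorem NFunction.exists_luxemburgNorm_le {G : Type*} [MeasurableSpace G] (Φ : NFunction)
    (μ : Measure G) [IsFiniteMeasure μ] :
    ∃ C : ℝ, 0 ≤ C ∧ ∀ (f : G → ℂ) (B : ℝ), (∀ x, ‖f x‖ ≤ B) →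
      luxemburgNorm Φ.toFun μ f ≤ ENNReal.ofReal (C * B) := by
  have hM : (0 : ℝ) < 1 / (μ.real Set.univ + 1) := by positivity
  -- Some `s > 0` has `Φ s * μ(G) ≤ 1`; then `1 / s` is a suitable constant.
  obtain ⟨s, hs, hs0, hs1⟩ : ∃ s, Φ.toFun s / s < 1 / (μ.real Set.univ + 1) ∧ 0 < s ∧ s < 1 := by
    have h : ∀ᶠ s in 𝓝[>] (0 : ℝ), Φ.toFun s / s < 1 / (μ.real Set.univ + 1) :=
      (Φ.tendsto_zero.mono_left (nhdsWithin_mono _ fun x hx => ne_of_gt hx)).eventually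
        (gt_mem_nhds hM)
    exact (h.and (Ioo_mem_nhdsGT one_pos)).exists
  refine ⟨1 / s, by positivity, fun f B hB => ?_⟩
  have hΦ : Φ.toFun s * μ.real Set.univ ≤ 1 := by
    have hm : (0 : ℝ) ≤ μ.real Set.univ := measureReal_nonneg
    rw [div_lt_div_iff₀ hs0 (by positivity)] at hs
    nlinarith [Φ.nonneg s]
  rcases isEmpty_or_nonempty G with hG | ⟨⟨x₀⟩⟩
  · have : f = fun _ => 0 := Subsingleton.elim _ _
    rw [this, luxemburgNorm_zero]
    exact zero_le
  rcases ((norm_nonneg _).trans (hB x₀)).eq_or_lt with rfl | hB0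
  · have : f = fun _ => 0 := funext fun x => norm_le_zero_iff.1 (hB x)
    rw [this, luxemburgNorm_zero]
    exact zero_le
  · refine iInf₂_le (1 / s * B) ⟨by positivity, ?_⟩
    calc orliczModular Φ.toFun μ (fun x => f x / ((1 / s * B : ℝ) : ℂ))
        ≤ ∫⁻ _, ENNReal.ofReal (Φ.toFun s) ∂μ := by
          refine lintegral_mono fun x => ENNReal.ofReal_le_ofReal (Φ.mono (norm_nonneg _) ?_)
          rw [norm_div, Complex.norm_real, Real.norm_of_nonneg (by positivity),
            div_le_iff₀ (by positivity)]
          have : s * (1 / s * B) = B := by field_simp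
          rw [this]
          exact hB x
      _ = ENNReal.ofReal (Φ.toFun s * μ.real Set.univ) := by
          rw [lintegral_const, ENNReal.ofReal_mul (Φ.nonneg s), ofReal_measureReal]
      _ ≤ 1 := ENNReal.ofReal_le_one.2 hΦ

namespace FTHO

/-! ### Convolutions of continuous functions as elements of the algebra -/

section Conv

variable {G : Type*} [Group G] [TopologicalSpace G] [IsTopologicalGroup G] [CompactSpace G]
  [MeasurableSpace G] [BorelSpace G] (Φ : NFunction) (μ : Measure G) [IsFiniteMeasureOnCompacts μ]

/-- The convolution of two continuous functions, as an element of `A_Φ(G)`. -/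
noncomputable def ofConv (f g : C(G, ℂ)) : FTHO Φ μ :=
  ⟨ZeroAtInftyContinuousMap.ContinuousMap.liftZeroAtInfty
    ⟨haarConv μ f g, continuous_haarConv f.continuous g.continuous⟩,
    ⟨_, _, isFthoRep_haarConv f.continuous g.continuous⟩⟩

variable {Φ μ}

theorem ofConv_apply (f g : C(G, ℂ)) (x : G) :
    ofConv Φ μ f g x = ∫ y, f y * g (y⁻¹ * x) ∂μ := rfl

variable (Φ μ) in
/-- For continuous `f` and `g`, `‖f * g‖_{A_Φ}` is at most a constant (depending on `g`) times the
supremum norm of `f`. -/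
theorem exists_norm_ofConv_le (g : C(G, ℂ)) : ∃ C : ℝ, ∀ f, ‖ofConv Φ μ f g‖ ≤ C * ‖f‖ := by
  have : IsFiniteMeasure μ := ⟨isCompact_univ.measure_lt_top⟩
  obtain ⟨C, hC0, hC⟩ := Φ.exists_luxemburgNorm_le μ
  have hg : orliczNorm Φ.toFun μ (fun x => g x⁻¹) < ∞ := orliczNorm_lt_top Φ
    (memMorseTransue_of_continuous (fun _ _ => Φ.compl_mono) (by fun_prop))
  refine ⟨C * (orliczNorm Φ.toFun μ (fun x => g x⁻¹)).toReal, fun f => ?_⟩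
  have h : fthoENorm Φ μ (ofConv Φ μ f g)
      ≤ ENNReal.ofReal (C * ‖f‖) * orliczNorm Φ.toFun μ (fun x => g x⁻¹) := by
    refine (isFthoRep_haarConv (Φ := Φ) f.continuous g.continuous).fthoENorm_le.trans ?_
    unfold fthoCost
    rw [tsum_eq_single 0 (fun n hn => by simp [hn, luxemburgNorm_zero])]
    simpa using mul_le_mul_left (hC f ‖f‖ f.norm_coe_le_norm) _
  have := ENNReal.toReal_mono (ENNReal.mul_ne_top ENNReal.ofReal_ne_top hg.ne) h
  rw [ENNReal.toReal_mul, ENNReal.toReal_ofReal (by positivity)] at this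
  rw [norm_def]
  linarith

variable (Φ μ) in
/-- The bounded linear map `f ↦ f * g` from `C(G)` to `A_Φ(G)`, for a continuous function `g`. -/
noncomputable def convCLM [μ.IsMulLeftInvariant] (g : C(G, ℂ)) : C(G, ℂ) →L[ℂ] FTHO Φ μ :=
  LinearMap.mkContinuousOfExistsBound
    { toFun := fun f => ofConv Φ μ f g
      map_add' := fun f f' => by
        ext x
        simp only [ofConv_apply, add_apply, ContinuousMap.add_apply, add_mul]
        exact integral_add (integrable_of_continuous (by fun_prop))
          (integrable_of_continuous (by fun_prop))
      map_smul' := fun c f => by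
        ext x
        simp only [ofConv_apply, smul_apply, ContinuousMap.smul_apply, smul_eq_mul, mul_assoc,
          integral_const_mul, RingHom.id_apply] }
    (exists_norm_ofConv_le Φ μ g)

theorem convCLM_apply [μ.IsMulLeftInvariant] (g f : C(G, ℂ)) (x : G) :
    convCLM Φ μ g f x = ∫ y, f y * g (y⁻¹ * x) ∂μ := rfl

/-- An element of `A_Φ(G)` as a continuous function. -/
noncomputable def toContinuousMap (u : FTHO Φ μ) : C(G, ℂ) := ⟨u, u.continuous⟩

@[simp]
theorem toContinuousMap_apply (u : FTHO Φ μ) (x : G) : u.toContinuousMap x = u x := rfl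

theorem convCLM_toContinuousMap [μ.IsMulLeftInvariant] (u v : FTHO Φ μ) :
    convCLM Φ μ v.toContinuousMap u.toContinuousMap = u * v := rfl

/-- The left translates `L_y f : x ↦ f (y⁻¹ x)` of a continuous function `f`, as a continuous map
`y ↦ L_y f` into the Banach space `C(G)`. -/
noncomputable def translates (f : C(G, ℂ)) : C(G, C(G, ℂ)) :=
  ContinuousMap.curry ⟨fun p => f (p.1⁻¹ * p.2), by fun_prop⟩

@[simp]
theorem translates_apply (f : C(G, ℂ)) (y x : G) : translates f y x = f (y⁻¹ * x) := rfl

theorem translates_one (f : C(G, ℂ)) : translates f 1 = f := by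
  ext x
  simp

/-- Convolution commutes with left translation of the left factor. -/
theorem convCLM_translates [μ.IsMulLeftInvariant] (g f : C(G, ℂ)) (z x : G) :
    convCLM Φ μ g (translates f z) x = convCLM Φ μ g f (z⁻¹ * x) := by
  simp only [convCLM_apply, translates_apply]
  rw [← integral_mul_left_eq_self _ z]
  simp only [inv_mul_cancel_left, mul_inv_rev, mul_assoc]

/-- The convolution `f * g` is the Bochner integral `∫ f(y) L_y g dμ(y)` in `C(G)`, here seen
through a bounded linear functional `ψ` of `C(G)`. -/
theorem map_mul_eq_integral [μ.IsMulLeftInvariant] (ψ : C(G, ℂ) →L[ℂ] ℂ) (u v : FTHO Φ μ) :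
    ψ (u * v).toContinuousMap = ∫ y, u y * ψ (translates v.toContinuousMap y) ∂μ := by
  have hint : Integrable (fun y => u y • translates v.toContinuousMap y) μ := by
    refine Continuous.integrable_of_hasCompactSupport ?_ (HasCompactSupport.of_compactSpace _)
    exact u.continuous.smul (translates v.toContinuousMap).continuous
  have h : (u * v).toContinuousMap = ∫ y, u y • translates v.toContinuousMap y ∂μ := by
    ext x
    rw [toContinuousMap_apply, mul_apply,
      ← ContinuousMap.evalCLM_apply ℂ x (∫ y, u y • translates v.toContinuousMap y ∂μ),
      ← ContinuousLinearMap.integral_comp_comm _ hint]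
    rfl
  rw [h, ← ContinuousLinearMap.integral_comp_comm _ hint]
  simp only [map_smul, smul_eq_mul]

end Conv

section Comm

variable {G : Type*} [CommGroup G] [TopologicalSpace G] [IsTopologicalGroup G] [CompactSpace G]
  [MeasurableSpace G] [BorelSpace G] {Φ : NFunction} {μ : Measure G}

/-! ### The functionals given by the characters of the group -/

/-- The functional `u ↦ ∫ u χ dμ` on `A_Φ(G)`, for a continuous character `χ` of `G`. It is the
Fourier coefficient of `u` at `χ⁻¹`. -/
noncomputable def fourierCLM [IsFiniteMeasureOnCompacts μ] [μ.IsMulLeftInvariant]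
    (χ : PontryaginDual G) : FTHO Φ μ →L[ℂ] ℂ :=
  LinearMap.mkContinuous
    { toFun := fun u => ∫ x, u x * (χ x : ℂ) ∂μ
      map_add' := fun u v => by
        have hu := u.continuous
        have hv := v.continuous
        have hχ := map_continuous χ
        simp only [add_apply, add_mul]
        exact integral_add (integrable_of_continuous (by fun_prop))
          (integrable_of_continuous (by fun_prop))
      map_smul' := fun c u => by
        simp only [smul_apply, mul_assoc, integral_const_mul, RingHom.id_apply, smul_eq_mul] }
    (μ.real Set.univ) fun u => by
      have : IsFiniteMeasure μ := ⟨isCompact_univ.measure_lt_top⟩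
      rw [mul_comm]
      refine norm_integral_le_of_norm_le_const (Eventually.of_forall fun x => ?_)
      rw [norm_mul, Circle.norm_coe, mul_one, norm_def, ← toReal_enorm]
      exact ENNReal.toReal_mono (fthoENorm_ne_top u) (enorm_le_fthoENorm u x)

theorem fourierCLM_apply [IsFiniteMeasureOnCompacts μ] [μ.IsMulLeftInvariant]
    (χ : PontryaginDual G) (u : FTHO Φ μ) :
    fourierCLM χ u = ∫ x, u x * (χ x : ℂ) ∂μ := rfl

theorem fourierCLM_mul [IsFiniteMeasureOnCompacts μ] [μ.IsMulLeftInvariant]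
    (χ : PontryaginDual G) (u v : FTHO Φ μ) :
    fourierCLM χ (u * v) = fourierCLM χ u * fourierCLM χ v := by
  have hu := u.continuous
  have hv := v.continuous
  have hχ := map_continuous χ
  simp only [fourierCLM_apply, mul_apply, ← integral_mul_const]
  rw [integral_integral_swap_of_hasCompactSupport (by fun_prop)
    (HasCompactSupport.of_compactSpace _)]
  congr 1
  ext y
  rw [← integral_mul_left_eq_self _ y, ← integral_const_mul]
  congr 1
  ext x
  rw [inv_mul_cancel_left, map_mul, Circle.coe_mul]
  ring

/-- The inverse of a continuous character of `G`, as a complex-valued continuous function. -/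
noncomputable def invChar (χ : PontryaginDual G) : C(G, ℂ) :=
  ⟨fun x => (χ x⁻¹ : ℂ), by
    have hχ := map_continuous χ
    fun_prop⟩

/-- The element `χ⁻¹ * χ⁻¹ = μ(G) χ⁻¹` of `A_Φ(G)`. -/
theorem ofConv_invChar_apply [IsFiniteMeasureOnCompacts μ] (χ : PontryaginDual G) (x : G) :
    ofConv Φ μ (invChar χ) (invChar χ) x = μ.real Set.univ * (χ x⁻¹ : ℂ) := by
  have h : ∀ y, invChar χ y * invChar χ (y⁻¹ * x) = (χ x⁻¹ : ℂ) := fun y => by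
    change (χ y⁻¹ : ℂ) * (χ (y⁻¹ * x)⁻¹ : ℂ) = _
    rw [← Circle.coe_mul, ← map_mul]
    congr 2
    simp [mul_comm]
  simp only [ofConv_apply, h, integral_const, Complex.real_smul]

theorem integral_char_eq_zero [μ.IsMulLeftInvariant] {χ : PontryaginDual G} (hχ : χ ≠ 1) :
    ∫ x, (χ x : ℂ) ∂μ = 0 := by
  obtain ⟨a, ha⟩ : ∃ a, χ a ≠ 1 := by
    by_contra! h
    exact hχ (PontryaginDual.ext h)
  have h := integral_mul_left_eq_self (μ := μ) (fun x => (χ x : ℂ)) a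
  simp only [map_mul, Circle.coe_mul, integral_const_mul] at h
  refine (mul_left_eq_self₀.1 h).resolve_left fun h' => ha (Circle.ext ?_)
  rw [h', Circle.coe_one]

/-- The orthogonality relations. -/
theorem fourierCLM_ofConv_invChar_of_ne [IsFiniteMeasureOnCompacts μ] [μ.IsMulLeftInvariant]
    {χ ψ : PontryaginDual G} (h : ψ ≠ χ) :
    fourierCLM ψ (ofConv Φ μ (invChar χ) (invChar χ)) = 0 := by
  simp only [fourierCLM_apply, ofConv_invChar_apply, mul_assoc, integral_const_mul]
  have e : ∀ x, (χ x⁻¹ : ℂ) * (ψ x : ℂ) = ((χ⁻¹ * ψ : PontryaginDual G) x : ℂ) := fun x => by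
    rw [← Circle.coe_mul, map_inv]
    rfl
  simp only [e]
  rw [integral_char_eq_zero fun h' => h (inv_mul_eq_one.1 h').symm, mul_zero]

theorem fourierCLM_ofConv_invChar_ne_zero [μ.IsHaarMeasure] (χ : PontryaginDual G) :
    fourierCLM χ (ofConv Φ μ (invChar χ) (invChar χ)) ≠ 0 := by
  have : IsFiniteMeasure μ := ⟨isCompact_univ.measure_lt_top⟩
  have e : ∀ x, (χ x⁻¹ : ℂ) * (χ x : ℂ) = 1 := fun x => by
    rw [← Circle.coe_mul, ← map_mul, inv_mul_cancel, map_one, Circle.coe_one]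
  simp only [fourierCLM_apply, ofConv_invChar_apply, mul_assoc, e, mul_one, integral_const,
    Complex.real_smul]
  have : μ.real Set.univ ≠ 0 := by
    rw [Measure.real, ENNReal.toReal_ne_zero]
    exact ⟨(isOpen_univ.measure_pos μ Set.univ_nonempty).ne', measure_ne_top μ _⟩
  simp [this]

/-! ### Every multiplicative functional comes from a character -/

/-- The computation behind multiplicativity: `L_x(v * v) * L_y(v * v) = L_{xy}(v * v) * (v * v)`. -/
theorem convCLM_translates_mul_convCLM_translates [IsFiniteMeasureOnCompacts μ]
    [μ.IsMulLeftInvariant] (v : C(G, ℂ)) (x y : G) :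
    convCLM Φ μ v (translates v x) * convCLM Φ μ v (translates v y)
      = convCLM Φ μ v (translates v (x * y)) * convCLM Φ μ v v := by
  ext z
  simp only [mul_apply, convCLM_translates]
  rw [← integral_mul_left_eq_self _ y⁻¹]
  congr 1
  ext t
  congr 2
  · rw [mul_inv, mul_assoc]
  · rw [mul_inv_rev, inv_inv, mul_assoc, mul_left_comm, inv_mul_cancel_left]

/-- A bounded homomorphism from a group to the complex numbers has values in the unit circle. -/
theorem _root_.MonoidHom.norm_eq_one_of_bounded {G : Type*} [Group G] (χ : G →* ℂ) {C : ℝ}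
    (hC : ∀ x, ‖χ x‖ ≤ C) (x : G) : ‖χ x‖ = 1 := by
  have le_one : ∀ x, ‖χ x‖ ≤ 1 := fun x => by
    by_contra! h
    obtain ⟨n, hn⟩ := pow_unbounded_of_one_lt C h
    have := hC (x ^ n)
    rw [map_pow, norm_pow] at this
    linarith
  refine le_antisymm (le_one x) ?_
  have h : ‖χ x‖ * ‖χ x⁻¹‖ = 1 := by
    rw [← norm_mul, ← map_mul, mul_inv_cancel, map_one, norm_one]
  nlinarith [le_one x⁻¹, norm_nonneg (χ x)]

/-- A nonzero multiplicative bounded functional on `A_Φ(G)` is given by a continuous character. -/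
theorem exists_eq_fourierCLM [IsFiniteMeasureOnCompacts μ] [μ.IsMulLeftInvariant]
    (φ : FTHO Φ μ →L[ℂ] ℂ) (hφ : φ ≠ 0) (hmul : ∀ u v, φ (u * v) = φ u * φ v) :
    ∃ χ : PontryaginDual G, φ = fourierCLM χ := by
  obtain ⟨v, hv⟩ : ∃ v, φ v ≠ 0 := by
    by_contra! h
    exact hφ (ContinuousLinearMap.ext h)
  set v' := v.toContinuousMap with hv'
  set ψ : C(G, ℂ) →L[ℂ] ℂ := φ.comp (convCLM Φ μ v') with hψ
  have hψ_apply : ∀ u : FTHO Φ μ, ψ u.toContinuousMap = φ u * φ v := fun u => hmul u v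
  have hψv : ψ v' ≠ 0 := by
    rw [hv', hψ_apply]
    exact mul_ne_zero hv hv
  let χ₀ : G →* ℂ :=
    { toFun := fun x => ψ (translates v' x) / ψ v'
      map_one' := by rw [translates_one, div_self hψv]
      map_mul' := fun x y => by
        have h := congrArg φ (convCLM_translates_mul_convCLM_translates (Φ := Φ) (μ := μ) v' x y)
        rw [hmul, hmul] at h
        change ψ (translates v' x) * ψ (translates v' y) = ψ (translates v' (x * y)) * ψ v' at h
        rw [div_mul_div_comm, h, mul_div_mul_right _ _ hψv] }
  have hχ₀ : ∀ x, χ₀ x = ψ (translates v' x) / ψ v' := fun _ => rfl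
  have hcont : Continuous χ₀ :=
    (ψ.continuous.comp (translates v').continuous).div_const _
  obtain ⟨C, hC⟩ := isCompact_univ.exists_bound_of_continuousOn hcont.continuousOn
  have hnorm : ∀ x, ‖χ₀ x‖ = 1 := χ₀.norm_eq_one_of_bounded fun x => hC x (Set.mem_univ x)
  let χ : G →ₜ* Circle :=
    { toFun := fun x => ⟨χ₀ x, mem_sphere_zero_iff_norm.2 (hnorm x)⟩
      map_one' := Circle.ext (map_one χ₀)
      map_mul' := fun x y => Circle.ext (map_mul χ₀ x y)
      continuous_toFun := hcont.subtype_mk _ }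
  refine ⟨χ, ContinuousLinearMap.ext fun u => ?_⟩
  have h := map_mul_eq_integral ψ u v
  rw [hψ_apply, hmul, mul_assoc, ← hψ_apply, ← hv'] at h
  have e : ∀ y, ψ (translates v' y) = χ₀ y * ψ v' := fun y => by
    rw [hχ₀, div_mul_cancel₀ _ hψv]
  simp only [e, ← mul_assoc, integral_mul_const] at h
  exact mul_right_cancel₀ hψv h

/-! ### The character space -/

variable (Φ μ)

/-- The point of the character space given by a continuous character of `G`. -/
noncomputable def charOfDual [μ.IsHaarMeasure] (χ : PontryaginDual G) :
    WeakDual.characterSpace ℂ (FTHO Φ μ) :=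
  ⟨StrongDual.toWeakDual (fourierCLM χ),
    fun h => fourierCLM_ofConv_invChar_ne_zero (Φ := Φ) (μ := μ) χ (DFunLike.congr_fun h _),
    fourierCLM_mul χ⟩

theorem charOfDual_apply [μ.IsHaarMeasure] (χ : PontryaginDual G) (u : FTHO Φ μ) :
    (charOfDual Φ μ χ).1 u = fourierCLM χ u := rfl

theorem eq_of_charOfDual_ofConv_invChar_ne_zero [μ.IsHaarMeasure] {χ ψ : PontryaginDual G}
    (h : (charOfDual Φ μ ψ).1 (ofConv Φ μ (invChar χ) (invChar χ)) ≠ 0) : ψ = χ := by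
  by_contra h'
  exact h (fourierCLM_ofConv_invChar_of_ne h')

theorem bijective_charOfDual [μ.IsHaarMeasure] : Function.Bijective (charOfDual Φ μ) := by
  refine ⟨fun ψ χ h => eq_of_charOfDual_ofConv_invChar_ne_zero Φ μ (χ := χ) ?_, fun φ => ?_⟩
  · rw [h]
    exact fourierCLM_ofConv_invChar_ne_zero χ
  · obtain ⟨χ, hχ⟩ := exists_eq_fourierCLM (WeakDual.toStrongDual φ.1) (fun h => φ.2.1 h) φ.2.2
    exact ⟨χ, Subtype.ext hχ.symm⟩

theorem discreteTopology_characterSpace [μ.IsHaarMeasure] :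
    DiscreteTopology (WeakDual.characterSpace ℂ (FTHO Φ μ)) := by
  refine discreteTopology_iff_isOpen_singleton.2 fun φ => ?_
  obtain ⟨χ, rfl⟩ := (bijective_charOfDual Φ μ).2 φ
  have hopen : IsOpen {φ : WeakDual.characterSpace ℂ (FTHO Φ μ) |
      φ.1 (ofConv Φ μ (invChar χ) (invChar χ)) ≠ 0} :=
    isOpen_ne_fun ((WeakDual.eval_continuous _).comp continuous_subtype_val) continuous_const
  convert hopen using 1
  ext φ
  constructor
  · rintro rfl
    exact fourierCLM_ofConv_invChar_ne_zero χ
  · intro h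
    obtain ⟨ψ, rfl⟩ := (bijective_charOfDual Φ μ).2 φ
    rw [eq_of_charOfDual_ofConv_invChar_ne_zero Φ μ h]
    rfl

end Comm

end FTHO

theorem mainTheorem5 {G : Type*} [CommGroup G] [TopologicalSpace G] [IsTopologicalGroup G]
    [CompactSpace G] [T2Space G] [MeasurableSpace G] [BorelSpace G]
    (μ : Measure G) [μ.IsHaarMeasure] [μ.Regular] (Φ : NFunction) :
    Nonempty (WeakDual.characterSpace ℂ (FTHO Φ μ) ≃ₜ PontryaginDual G) := by
  have := FTHO.discreteTopology_characterSpace Φ μ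
  exact ⟨((Equiv.ofBijective _ (FTHO.bijective_charOfDual Φ μ)).toHomeomorphOfDiscrete).symm⟩
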